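/- Let $\mathbb K$ be a field and $n\in\mathbb N$. Equip $\mathbb K^{2n}$, with coordinates $(z_j,x_j)_{j<n}$, with the symplectic form $\omega_n((z,x),(z',x'))=\sum_j (z_jx'_j-x_jz'_j)$. An affine Lagrangian state on $n$ wires (an affine Lagrangian relation $0\to n$) is an affine subspace $L\subseteq\mathbb K^{2n}$ that is empty or whose direction equals its own symplectic complement. A string diagram is built from grey and white spiders and boxes, and is interpreted by relational composition and direct sum, each wire carrying a value in $\mathbb K^2$. A grey spider of phase $(a,b)$ is interpreted as $\{((z_i,x)_i,(z'_k,x)_k) : \sum_i z_i-\sum_k z'_k+bx=a\}$. A white spider of phase $(a,b)$ is interpreted as $\{((z,x_i)_i,(-z,x'_k)_k) : \sum_i x_i+\sum_k x'_k-bz=a\}$. A box labelled $c\ne0$ is interpreted as $\{((z,x),(-cx,z/c))\}$, and the box labelled $0$ as $\{((0,x),(0,x'))\}$. A diagram $0\to n$ in AP-form is given by $(m,E,Y,\vec x,\vec y)$ with $m\in\mathbb N$, $E\in\mathbb K^{m\times n}$, $Y\in\mathbb K^{n\times n}$ symmetric, $\vec x\in\mathbb K^m$, $\vec y\in\mathbb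 K^n$. It consists of $m$ internal grey spiders with phases $(x_i,0)$ and $n$ boundary grey spiders with phases $(y_j,Y_{jj})$, the $j$-th of which is connected to the $j$-th output. The $i$-th internal spider and the $j$-th boundary spider are joined through a box labelled $E_{ij}$ if $E_{ij}\neq0$. Distinct boundary spiders $j,k$ are joined through a box labelled $Y_{jk}$ if $Y_{jk}\ne0$. There are no other edges. It is in reduced AP-form if its interpretation is empty, or if the following four conditions hold: 1. $E$ is in reduced row echelon form; 2. $E$ is surjective; 3. if the $j$-th column of $E$ is a pivot column, then the $j$-th column of $Y$ is zero; 4. if the $j$-th column of $E$ is a pivot column, then $y_j=0$. Let $L$ be a nonempty affine Lagrangian state on $n$ wires. Then: (a) There is exactly one diagram in reduced AP-form whose interpretation is $L$; that is, exactly one tuple $(m,E,Y,\vec x,\vec y)$. (b) This diagram is determined by block data that are invariants of $L$. There is exactly one tuple $(m,\varsigma,F,\vec x,S,\vec s)$ with $m\le n$, $\varsigma$ a permutation of the $n$ wires, $F\in\mathbb K^{m\times(n-m)}$, $\vec x\in\mathbb K^m$, $S\in\mathbb K^{(n-m)\times(n-m)}$ symmetric and $\vec s\in\mathbb K^{n-m}$,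 such that the diagram given by $$E=\begin{bmatrix}1_m&F\end{bmatrix}\varsigma,\qquad Y=\varsigma^{\mathsf T}\begin{bmatrix}0&0\\0&S\end{bmatrix}\varsigma,\qquad \vec y=\varsigma^{\mathsf T}\begin{bmatrix}0\\ \vec s\end{bmatrix}$$ (and $m$, $\vec x$) is in reduced AP-form, has interpretation $L$, and $\varsigma$ separates the pivots. The last condition means that the pivot column of row $i$ is sent by $\varsigma$ to position $i$, for each $i$, that the non-pivot columns are sent to the last $n-m$ positions, and that $\varsigma$ preserves the order of the columns within each of these two groups. -/

import Mathlib

open scoped Matrix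

noncomputable section

namespace GSA

/-! ### Affine Lagrangian relations

A wire carries a pair `(z, x) : K × K`, so `K ^ (2 n)` is `Fin n → K × K`. -/

/-- The standard symplectic form on `K ^ (2 n)`. -/
def omega {K : Type*} [Field K] {n : ℕ} (v w : Fin n → K × K) : K :=
  ∑ j, ((v j).1 * (w j).2 - (v j).2 * (w j).1)

/-- The space in which relations from `k` to `n` wires live. -/
abbrev RelSpace (K : Type*) (k n : ℕ) : Type _ := (Fin k → K × K) × (Fin n → K × K)

/-- The twisted symplectic form `ω_k - ω_n` on the space of relations. -/
def twistedOmega {K : Type*} [Field K] {k n : ℕ} (p q : RelSpace K k n) : K :=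
  omega p.1 q.1 - omega p.2 q.2

/-- The symplectic complement of a linear subspace. -/
def symplecticComplement {K : Type*} [Field K] {k n : ℕ}
    (S : Submodule K (RelSpace K k n)) : Set (RelSpace K k n) :=
  {v | ∀ s ∈ S, twistedOmega v s = 0}

/-- A linear subspace is Lagrangian if it is equal to its symplectic complement. -/
def IsLagrangian {K : Type*} [Field K] {k n : ℕ}
    (S : Submodule K (RelSpace K k n)) : Prop :=
  (S : Set (RelSpace K k n)) = symplecticComplement S

/-- An affine Lagrangian relation `k → n`: an affine subspace which is empty or has a
Lagrangian direction. -/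
def IsAffineLagrangian {K : Type*} [Field K] {k n : ℕ}
    (L : AffineSubspace K (RelSpace K k n)) : Prop :=
  (L : Set (RelSpace K k n)) = ∅ ∨ IsLagrangian L.direction

/-! ### Generators of the calculus and their interpretation -/

/-- The grey spider of phase `(a, b)`, with input legs `ι` and output legs `κ`. -/
def greyRel {K : Type*} [Field K] (ι κ : Type) [Fintype ι] [Fintype κ] (a b : K) :
    Set ((ι → K × K) × (κ → K × K)) :=
  {p | ∃ x : K, (∀ i, (p.1 i).2 = x) ∧ (∀ o, (p.2 o).2 = x) ∧
    ∑ i, (p.1 i).1 - ∑ o, (p.2 o).1 + b * x = a}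

/-- The white spider of phase `(a, b)`, with input legs `ι` and output legs `κ`. -/
def whiteRel {K : Type*} [Field K] (ι κ : Type) [Fintype ι] [Fintype κ] (a b : K) :
    Set ((ι → K × K) × (κ → K × K)) :=
  {p | ∃ z : K, (∀ i, (p.1 i).1 = z) ∧ (∀ o, (p.2 o).1 = -z) ∧
    ∑ i, (p.1 i).2 + ∑ o, (p.2 o).2 - b * z = a}

/-- The box labelled `c`, relating the value `u` of its input to the value `w` of its output. -/
def boxRel {K : Type*} [Field K] (c : K) (u w : K × K) : Prop :=
  (c = 0 ∧ u.1 = 0 ∧ w.1 = 0) ∨ (c ≠ 0 ∧ w = (-c * u.2, u.1 / c))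

/-- The generators of the calculus. -/
inductive Generator (K : Type*) where
  | grey (a b : K) : Generator K
  | white (a b : K) : Generator K
  | box (c : K) : Generator K

/-- The relation interpreting a generator with input legs `ι` and output legs `κ`
(a box always has exactly one input and one output leg). -/
def Generator.rel {K : Type*} [Field K] (g : Generator K) (ι κ : Type) [Fintype ι] [Fintype κ] :
    Set ((ι → K × K) × (κ → K × K)) :=
  match g with
  | .grey a b => greyRel ι κ a b
  | .white a b => whiteRel ι κ a b
  | .box c => {p | ∀ i o, boxRel c (p.1 i) (p.2 o)}

/-! ### String diagrams -/

/-- A string diagram `k → n` over the generators: an acyclic directed graph whose nodes are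
generators and whose wires run from their source (an input of the diagram or a node) to their
target (an output of the diagram or a node). The legs of a node need not be ordered, because
the spiders are invariant under permutations of their inputs and of their outputs. -/
structure Diagram (K : Type*) (k n : ℕ) where
  Node : Type
  Wire : Type
  [fintypeNode : Fintype Node]
  [fintypeWire : Fintype Wire]
  label : Node → Generator K
  src : Wire → Fin k ⊕ Node
  tgt : Wire → Fin n ⊕ Node
  input : Fin k → Wire
  output : Fin n → Wire
  src_eq_inl : ∀ w i, src w = Sum.inl i ↔ w = input i
  tgt_eq_inl : ∀ w j, tgt w = Sum.inl j ↔ w = output j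
  box_arity : ∀ v c, label v = Generator.box c →
    (∃! w, tgt w = Sum.inr v) ∧ ∃! w, src w = Sum.inr v
  acyclic : ∃ rank : Node → ℕ, ∀ w u v, src w = Sum.inr u → tgt w = Sum.inr v → rank u < rank v

attribute [instance] Diagram.fintypeNode Diagram.fintypeWire

open Classical in
/-- The interpretation of a diagram as a relation, obtained from the interpretation of its
generators by relational composition and direct sum: the boundary values which extend to an
assignment of values to all wires that satisfies the relation of each node. -/
def Diagram.interp {K : Type*} [Field K] {k n : ℕ} (D : Diagram K k n) :
    Set (RelSpace K k n) :=
  {p | ∃ val : D.Wire → K × K,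
    (∀ i, p.1 i = val (D.input i)) ∧ (∀ j, p.2 j = val (D.output j)) ∧
    ∀ v : D.Node,
      ((fun w : {w : D.Wire // D.tgt w = Sum.inr v} => val w.1),
        (fun w : {w : D.Wire // D.src w = Sum.inr v} => val w.1)) ∈
      (D.label v).rel {w : D.Wire // D.tgt w = Sum.inr v} {w : D.Wire // D.src w = Sum.inr v}}

/-! ### Graph-like states -/

/-- The data of a graph-like state `0 → n` with internal vertices `Fin m` and boundary vertices
`Fin n`. The vertex `v` is a grey spider of phase `(phase v, adj v v)`; two distinct vertices
`v, w` with `adj v w ≠ 0` are joined by an edge carrying a box labelled `adj v w`. -/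
structure GraphLike (K : Type*) (m n : ℕ) where
  adj : Matrix (Fin m ⊕ Fin n) (Fin m ⊕ Fin n) K
  symm : adj.IsSymm
  phase : Fin m ⊕ Fin n → K

/-- The edges, each listed once, from its earlier to its later end. -/
abbrev GraphLike.Edge {K : Type*} [Field K] {m n : ℕ} (G : GraphLike K m n) : Type :=
  {e : (Fin m ⊕ Fin n) × (Fin m ⊕ Fin n) //
    finSumFinEquiv e.1 < finSumFinEquiv e.2 ∧ G.adj e.1 e.2 ≠ 0}

open Classical in
/-- The string diagram of a graph-like state. Its nodes are the vertices and one box per edge.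
Its wires are, for each edge `e`, one from the first end of `e` to the box and one from the box
to the second end, and one from the `j`-th boundary vertex to the `j`-th output. -/
def GraphLike.toDiagram {K : Type*} [Field K] {m n : ℕ} (G : GraphLike K m n) :
    Diagram K 0 n where
  Node := (Fin m ⊕ Fin n) ⊕ G.Edge
  Wire := (G.Edge ⊕ G.Edge) ⊕ Fin n
  label
    | .inl v => .grey (G.phase v) (G.adj v v)
    | .inr e => .box (G.adj e.1.1 e.1.2)
  src
    | .inl (.inl e) => .inr (.inl e.1.1)
    | .inl (.inr e) => .inr (.inr e)
    | .inr j => .inr (.inl (.inr j))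
  tgt
    | .inl (.inl e) => .inr (.inr e)
    | .inl (.inr e) => .inr (.inl e.1.2)
    | .inr j => .inl j
  input := Fin.elim0
  output j := .inr j
  src_eq_inl _ i := i.elim0
  tgt_eq_inl w j := by rcases w with (e | e) | j' <;> simp
  box_arity v c h := by
    rcases v with v | e
    · simp at h
    · refine ⟨⟨.inl (.inl e), rfl, ?_⟩, ⟨.inl (.inr e), rfl, ?_⟩⟩
      · rintro ((e' | e') | j) h' <;> simp_all
      · rintro ((e' | e') | j) h' <;> simp_all
  acyclic := by
    refine ⟨Sum.elim (fun v => 2 * (finSumFinEquiv v : ℕ))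
      (fun e => 2 * (finSumFinEquiv e.1.1 : ℕ) + 1), ?_⟩
    rintro ((e | e) | j) u v hu hv
    · simp only [Sum.inr.injEq] at hu hv
      subst hu hv
      simp
    · simp only [Sum.inr.injEq] at hu hv
      subst hu hv
      have := e.2.1
      simp only [Fin.lt_def] at this
      simp only [Sum.elim_inl, Sum.elim_inr]
      omega
    · simp at hv

/-! ### AP-form and reduced AP-form -/

/-- A state `0 → n` in AP-form: `m` internal spiders with phases `(x i, 0)`, `n` boundary
spiders with affine phases `y`, edges between internal and boundary spiders given by `E`, and
edges between boundary spiders, with their symplectic phases on the diagonal, given by `Y`. -/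
@[ext]
structure APForm (K : Type*) (n : ℕ) where
  m : ℕ
  E : Matrix (Fin m) (Fin n) K
  Y : Matrix (Fin n) (Fin n) K
  Y_symm : Y.IsSymm
  x : Fin m → K
  y : Fin n → K

/-- The graph-like state given by the data of an AP-form; internal vertices have symplectic
phase zero and there are no edges between them. -/
def APForm.toGraphLike {K : Type*} [Field K] {n : ℕ} (D : APForm K n) : GraphLike K D.m n where
  adj := Matrix.fromBlocks 0 D.E D.Eᵀ D.Y
  symm := Matrix.IsSymm.fromBlocks Matrix.isSymm_zero rfl D.Y_symm
  phase := Sum.elim D.x D.y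

/-- The relation `0 → n` interpreting a diagram in AP-form. -/
def APForm.interp {K : Type*} [Field K] {n : ℕ} (D : APForm K n) : Set (RelSpace K 0 n) :=
  D.toGraphLike.toDiagram.interp

/-- The leading (first nonzero) entry of row `i` is in column `j`. -/
def IsLeading {K : Type*} [Field K] {m n : ℕ} (E : Matrix (Fin m) (Fin n) K)
    (i : Fin m) (j : Fin n) : Prop :=
  E i j ≠ 0 ∧ ∀ j' < j, E i j' = 0

/-- Reduced row echelon form: leading entries are `1` and are the only nonzero entries of their
column; and above a nonzero row there are only nonzero rows, with leading entries further to the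
left. The pivot columns are those which contain a leading entry. -/
def IsRREF {K : Type*} [Field K] {m n : ℕ} (E : Matrix (Fin m) (Fin n) K) : Prop :=
  (∀ i j, IsLeading E i j → E i j = 1 ∧ ∀ i', i' ≠ i → E i' j = 0) ∧
  (∀ i i' j', i < i' → IsLeading E i' j' → ∃ j < j', IsLeading E i j)

/-- Reduced AP-form. -/
def APForm.IsReduced {K : Type*} [Field K] {n : ℕ} (D : APForm K n) : Prop :=
  D.interp = ∅ ∨
  (IsRREF D.E ∧
    Function.Surjective D.E.mulVec ∧
    (∀ i j, IsLeading D.E i j → ∀ k, D.Y k j = 0) ∧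
    (∀ i j, IsLeading D.E i j → D.y j = 0))

/-- The block data `(m, ς, F, x, S, s)` of a reduced AP-form. -/
@[ext]
structure BlockData (K : Type*) (n : ℕ) where
  m : ℕ
  le : m ≤ n
  perm : Equiv.Perm (Fin n)
  F : Matrix (Fin m) (Fin (n - m)) K
  x : Fin m → K
  S : Matrix (Fin (n - m)) (Fin (n - m)) K
  S_symm : S.IsSymm
  s : Fin (n - m) → K

/-- The permutation `ς`, with its codomain split into a block of size `m` and one of size
`n - m`. -/
def BlockData.split {K : Type*} {n : ℕ} (d : BlockData K n) :
    Fin n ≃ Fin d.m ⊕ Fin (n - d.m) :=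
  (d.perm.trans (finCongr (Nat.add_sub_of_le d.le).symm)).trans finSumFinEquiv.symm

/-- The AP-form with `E = [1 F] ς`, `Y = ςᵀ [0 0; 0 S] ς` and `y = ςᵀ [0; s]`, where the
permutation matrix `ς` has its ones in the entries `(ς j, j)`. -/
def BlockData.toAPForm {K : Type*} [Field K] {n : ℕ} (d : BlockData K n) : APForm K n where
  m := d.m
  E := (Matrix.fromCols 1 d.F).submatrix id d.split
  Y := (Matrix.fromBlocks 0 0 0 d.S).submatrix d.split d.split
  Y_symm := Matrix.IsSymm.submatrix
    (Matrix.IsSymm.fromBlocks Matrix.isSymm_zero Matrix.transpose_zero d.S_symm) _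
  x := d.x
  y := Sum.elim 0 d.s ∘ d.split

/-- The permutation moves the pivot columns, where row `i` has its leading entry in the column
sent to `i`, to the first block and the other columns to the second block, and keeps the order
within each of the blocks. -/
def BlockData.SeparatesPivots {K : Type*} [Field K] {n : ℕ} (d : BlockData K n) : Prop :=
  (∀ i : Fin d.m, IsLeading d.toAPForm.E i (d.split.symm (Sum.inl i))) ∧
  StrictMono (fun i : Fin d.m => d.split.symm (Sum.inl i)) ∧
  StrictMono (fun j : Fin (n - d.m) => d.split.symm (Sum.inr j))

end GSA

end

/-!
The legs of a grey spider share their second coordinate, and a box determines the first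
coordinates on its two wires from the second coordinates of the spiders that it joins. The
interpretation of an AP-form is therefore the solution set of a linear system: writing `B` for `Y`
with the off-diagonal entries negated (`signTwist`), it consists of the `(z, x)` with `E x = -ξ` and
`z ∈ B x - y + rowSpace E`, where `ξ` are the internal phases (`APForm.mem_interp`).

Uniqueness (`APForm.IsNormal.unique`). The row space of `E` is the set of differences of the `z`
which occur over one `x`, so it is determined by the state, and a subspace has only one basis in
reduced row echelon form (`HasPivots.unique`). The vector `ξ` is read off from any solution. If
`B, y` and `B', y'` give the same state, then `(B x - y) - (B' x - y')` lies in the row space and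
vanishes in the pivot columns, so it is zero for every `x` with `E x = -ξ`. As `B` and `B'` vanish
in the pivot columns and `ker E` projects onto the other coordinates, `B = B'` and `y = y'`.

Existence (`exists_isNormal_of_lagrangian`). For a Lagrangian subspace `M`, the fibre
`V = {z | (z, 0) ∈ M}` and the set `W` of second coordinates are orthogonal complements of each
other. Hence an echelon basis `E` of `V` has kernel `W`. Over each `x ∈ W` there is exactly one
point of `M` whose first coordinate vanishes in the pivot columns. It depends linearly on the free
coordinates of `x`, and since `M` is isotropic, the matrix `B` of this map is symmetric.

The block data encode the same echelon form after sorting the columns. Enumerating the pivot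
columns and the other columns increasingly determines the permutation, and the blocks are then
submatrices of `E` and `Y`.
-/

open scoped Matrix

noncomputable section

namespace GSA

variable {K : Type*} [Field K]

/-! ### Interpretation of graph-like states -/

theorem sum_subtype_ite {ι : Type*} [Fintype ι] {p : ι → Prop} [DecidablePred p]
    {F : Fintype (Subtype p)} (f : ι → K) :
    ∑ a : Subtype p, f a = ∑ a, if p a then f a else 0 := by
  rw [← Finset.sum_filter]
  exact (Finset.sum_subtype _ (by simp) f).symm

open Classical in
theorem sum_edge {m n : ℕ} (G : GraphLike K m n) (f : Fin m ⊕ Fin n → Fin m ⊕ Fin n → K) :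
    ∑ e : G.Edge, G.adj e.1.1 e.1.2 * f e.1.1 e.1.2 =
      ∑ u, ∑ w, if finSumFinEquiv u < finSumFinEquiv w then G.adj u w * f u w else 0 := by
  rw [sum_subtype_ite (fun e : (Fin m ⊕ Fin n) × (Fin m ⊕ Fin n) => G.adj e.1 e.2 * f e.1 e.2),
    Fintype.sum_prod_type]
  refine Finset.sum_congr rfl fun u _ => Finset.sum_congr rfl fun w _ => ?_
  by_cases h : G.adj u w = 0 <;> simp [h]

open Classical in
/-- The edges at `v` enter the equation of `v` symmetrically: whether `v` is the earlier or the
later end of an edge makes no difference. -/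
theorem sum_edges_at {m n : ℕ} (G : GraphLike K m n) (t : Fin m ⊕ Fin n → K)
    (v : Fin m ⊕ Fin n) :
    (∑ e : G.Edge, if e.1.2 = v then -G.adj e.1.1 e.1.2 * t e.1.1 else 0) -
      (∑ e : G.Edge, if e.1.1 = v then G.adj e.1.1 e.1.2 * t e.1.2 else 0) =
      -∑ w, if w = v then 0 else G.adj v w * t w := by
  have h1 := sum_edge G (fun a b => if b = v then t a else 0)
  have h2 := sum_edge G (fun a b => if a = v then t b else 0)
  have e1 : (∑ e : G.Edge, if e.1.2 = v then -G.adj e.1.1 e.1.2 * t e.1.1 else 0) =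
      -∑ u, if finSumFinEquiv u < finSumFinEquiv v then G.adj v u * t u else 0 := by
    have h : (∑ u, if finSumFinEquiv u < finSumFinEquiv v then G.adj v u * t u else 0) =
        ∑ u, ∑ w, if finSumFinEquiv u < finSumFinEquiv w then
          G.adj u w * (if w = v then t u else 0) else 0 := by
      refine Finset.sum_congr rfl fun u _ => ?_
      rw [Finset.sum_eq_single v (by simp +contextual) (by simp)]
      simp [G.symm.apply v u]
    rw [h, ← h1, ← Finset.sum_neg_distrib]
    exact Finset.sum_congr rfl fun e _ => by split_ifs <;> simp
  have e2 : (∑ e : G.Edge, if e.1.1 = v then G.adj e.1.1 e.1.2 * t e.1.2 else 0) =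
      ∑ w, if finSumFinEquiv v < finSumFinEquiv w then G.adj v w * t w else 0 := by
    rw [Finset.sum_congr rfl fun e _ => (mul_ite_zero _ _ _).symm, h2,
      Finset.sum_eq_single v (by simp +contextual) (by simp)]
    simp
  rw [e1, e2, ← neg_add', ← Finset.sum_add_distrib]
  congr 1
  refine Finset.sum_congr rfl fun w _ => ?_
  rcases lt_trichotomy (finSumFinEquiv w) (finSumFinEquiv v) with h | h | h
  · have : w ≠ v := by rintro rfl; exact lt_irrefl _ h
    simp [h, h.not_gt, this]
  · have : w = v := finSumFinEquiv.injective h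
    simp [this]
  · have : w ≠ v := by rintro rfl; exact lt_irrefl _ h
    simp [h, h.not_gt, this]

open Classical in
/-- All legs of the vertex `v` carry the same second coordinate `t v`. A box then forces the
first coordinates on its two legs, so that only the linear equations of the vertices remain. -/
theorem mem_interp_toDiagram {m n : ℕ} (G : GraphLike K m n) (q : RelSpace K 0 n) :
    q ∈ G.toDiagram.interp ↔ ∃ t : Fin m ⊕ Fin n → K, (∀ j, (q.2 j).2 = t (.inr j)) ∧
      ∀ v, G.adj v v * t v - (∑ w, if w = v then 0 else G.adj v w * t w)
        - Sum.elim (fun _ => 0) (fun j => (q.2 j).1) v = G.phase v := by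
  have hin : ∀ (f : G.toDiagram.Wire → K) (v : Fin m ⊕ Fin n)
      {_ : Fintype {w : G.toDiagram.Wire // G.toDiagram.tgt w = Sum.inr (Sum.inl v)}},
      ∑ w : {w : G.toDiagram.Wire // G.toDiagram.tgt w = Sum.inr (Sum.inl v)}, f w.1 =
        ∑ e : G.Edge, if e.1.2 = v then f (.inl (.inr e)) else 0 := by
    intro f v _
    rw [sum_subtype_ite f]
    change ∑ a : (G.Edge ⊕ G.Edge) ⊕ Fin n, _ = _
    rw [Fintype.sum_sum_type, Fintype.sum_sum_type]
    simp [GraphLike.toDiagram]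
  have hout : ∀ (f : G.toDiagram.Wire → K) (v : Fin m ⊕ Fin n)
      {_ : Fintype {w : G.toDiagram.Wire // G.toDiagram.src w = Sum.inr (Sum.inl v)}},
      ∑ w : {w : G.toDiagram.Wire // G.toDiagram.src w = Sum.inr (Sum.inl v)}, f w.1 =
        (∑ e : G.Edge, if e.1.1 = v then f (.inl (.inl e)) else 0) +
          Sum.elim (fun _ => 0) (fun j => f (.inr j)) v := by
    intro f v _
    rw [sum_subtype_ite f]
    change ∑ a : (G.Edge ⊕ G.Edge) ⊕ Fin n, _ = _
    rw [Fintype.sum_sum_type, Fintype.sum_sum_type]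
    rcases v with v | v <;> simp [GraphLike.toDiagram]
  constructor
  · rintro ⟨val, -, hq, hval⟩
    choose t ht1 ht2 ht3 using fun v => hval (.inl v)
    have hbox : ∀ e : G.Edge, boxRel (G.adj e.1.1 e.1.2) (val (.inl (.inl e)))
        (val (.inl (.inr e))) := fun e =>
      hval (.inr e) ⟨.inl (.inl e), rfl⟩ ⟨.inl (.inr e), rfl⟩
    have hs : ∀ e : G.Edge, (val (.inl (.inl e))).2 = t e.1.1 := fun e =>
      ht2 e.1.1 ⟨.inl (.inl e), rfl⟩
    have hs' : ∀ e : G.Edge, (val (.inl (.inr e))).2 = t e.1.2 := fun e =>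
      ht1 e.1.2 ⟨.inl (.inr e), rfl⟩
    have hz' : ∀ e : G.Edge, (val (.inl (.inr e))).1 = -G.adj e.1.1 e.1.2 * t e.1.1 := by
      intro e
      obtain ⟨h, -⟩ | ⟨-, h⟩ := hbox e
      · exact absurd h e.2.2
      · rw [h, ← hs e]
    have hz : ∀ e : G.Edge, (val (.inl (.inl e))).1 = G.adj e.1.1 e.1.2 * t e.1.2 := by
      intro e
      obtain ⟨h, -⟩ | ⟨h0, h⟩ := hbox e
      · exact absurd h e.2.2
      · rw [← hs' e, h, mul_div_cancel₀ _ h0]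
    have hqj : ∀ j, q.2 j = val (.inr j) := hq
    refine ⟨t, fun j => ?_, fun v => ?_⟩
    · rw [hqj]
      exact ht2 (.inr j) ⟨.inr j, rfl⟩
    · have h3 := ht3 v
      have hs3 := (congrArg (· + G.adj v v * t v) (congrArg₂ (· - ·)
        (hin (fun w => (val w).1) v) (hout (fun w => (val w).1) v))).symm.trans h3
      simp only [hz, hz'] at hs3
      rw [← sub_sub, sum_edges_at] at hs3
      simp only [hqj]
      linear_combination hs3
  · rintro ⟨t, ht, hv⟩
    let val : (G.Edge ⊕ G.Edge) ⊕ Fin n → K × K := Sum.elim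
      (Sum.elim (fun e => (G.adj e.1.1 e.1.2 * t e.1.2, t e.1.1))
        (fun e => (-G.adj e.1.1 e.1.2 * t e.1.1, t e.1.2))) q.2
    refine ⟨val, fun i => i.elim0, fun j => rfl, ?_⟩
    rintro (v | e)
    · refine ⟨t v, ?_, ?_, ?_⟩
      · rintro ⟨(e | e) | j, h⟩ <;> simp [GraphLike.toDiagram] at h
        simp [val, h]
      · rintro ⟨(e | e) | j, h⟩ <;> simp [GraphLike.toDiagram] at h
        · simp [val, h]
        · simp [val, ht, h]
      · refine (congrArg (· + G.adj v v * t v) (congrArg₂ (· - ·)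
          (hin (fun w => (val w).1) v) (hout (fun w => (val w).1) v))).trans ?_
        simp only [val, Sum.elim_inl, Sum.elim_inr]
        rw [← sub_sub, sum_edges_at, ← hv v]
        ring
    · rintro ⟨(e1 | e1) | j, h⟩ ⟨(e2 | e2) | j', h'⟩ <;>
        simp [GraphLike.toDiagram] at h h'
      subst h h'
      right
      have := e2.2.2
      refine ⟨this, ?_⟩
      simp [val, this]

/-! ### The linear system of an AP-form -/

/-- Negate the entries off the diagonal. A boundary spider's own phase and the edges to the other
boundary spiders enter its equation with opposite signs. -/
def signTwist {n : ℕ} (Y : Matrix (Fin n) (Fin n) K) : Matrix (Fin n) (Fin n) K :=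
  Matrix.of fun j k => if k = j then Y j j else -Y j k

theorem signTwist_signTwist {n : ℕ} (Y : Matrix (Fin n) (Fin n) K) :
    signTwist (signTwist Y) = Y := by
  ext j k
  by_cases h : k = j
  · subst h; simp [signTwist]
  · simp [signTwist, h]

theorem signTwist_isSymm {n : ℕ} {Y : Matrix (Fin n) (Fin n) K} (hY : Y.IsSymm) :
    (signTwist Y).IsSymm := by
  refine Matrix.IsSymm.ext fun j k => ?_
  by_cases h : k = j
  · subst h; rfl
  · simp [signTwist, h, Ne.symm h, hY.apply j k]

theorem signTwist_apply_eq_zero {n : ℕ} {Y : Matrix (Fin n) (Fin n) K} {j k : Fin n}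
    (h : Y j k = 0) : signTwist Y j k = 0 := by
  by_cases hk : k = j
  · subst hk; simpa [signTwist] using h
  · simp [signTwist, hk, h]

/-- The internal spiders impose `E x = -ξ` on the second coordinates, and their own second
coordinates `l` are free, which leaves the first coordinates undetermined up to the row space
of `E`. -/
theorem APForm.mem_interp {n : ℕ} (D : APForm K n) (q : RelSpace K 0 n) :
    q ∈ D.interp ↔ D.E *ᵥ (fun j => (q.2 j).2) = -D.x ∧
      ∃ l, (fun j => (q.2 j).1) = signTwist D.Y *ᵥ (fun j => (q.2 j).2) - D.y - D.Eᵀ *ᵥ l := by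
  have key : ∀ (t : Fin n → K) (j : Fin n), (signTwist D.Y *ᵥ t) j =
      D.Y j j * t j - ∑ k, if k = j then 0 else D.Y j k * t k := by
    intro t j
    have h : D.Y j j * t j = ∑ k, if k = j then D.Y j j * t j else 0 := by simp
    rw [h, ← Finset.sum_sub_distrib, Matrix.mulVec, dotProduct]
    refine Finset.sum_congr rfl fun k _ => ?_
    by_cases hk : k = j
    · subst hk; simp [signTwist]
    · simp [signTwist, hk]
  rw [APForm.interp, mem_interp_toDiagram]
  constructor
  · rintro ⟨t, ht, hv⟩
    have ht' : (fun j => (q.2 j).2) = fun j => t (.inr j) := funext ht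
    rw [ht']
    refine ⟨funext fun i => ?_, fun i => t (.inl i), funext fun j => ?_⟩
    · have := hv (.inl i)
      simp [APForm.toGraphLike, Fintype.sum_sum_type] at this
      simp [Matrix.mulVec, dotProduct, ← this]
    · have := hv (.inr j)
      simp [APForm.toGraphLike, Fintype.sum_sum_type] at this
      simp only [Pi.sub_apply, key, ← this]
      simp only [Matrix.mulVec, dotProduct, Matrix.transpose_apply]
      ring
  · rintro ⟨hE, l, hl⟩
    refine ⟨Sum.elim l fun j => (q.2 j).2, fun j => rfl, ?_⟩
    rintro (i | j)
    · have := congrFun hE i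
      simp [Matrix.mulVec, dotProduct] at this
      simp [APForm.toGraphLike, Fintype.sum_sum_type, this]
    · have := congrFun hl j
      simp only [Pi.sub_apply, key] at this
      simp [Matrix.mulVec, dotProduct] at this
      simp [APForm.toGraphLike, Fintype.sum_sum_type, this]
      ring

/-! ### Reduced row echelon bases -/

/-- `E` is in reduced row echelon form without zero rows, with pivot columns `p`. -/
structure HasPivots {m n : ℕ} (E : Matrix (Fin m) (Fin n) K) (p : Fin m → Fin n) : Prop where
  strictMono : StrictMono p
  submatrix_eq_one : E.submatrix id p = 1
  eq_zero_of_lt : ∀ i j, j < p i → E i j = 0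

namespace HasPivots

variable {m n : ℕ} {E : Matrix (Fin m) (Fin n) K} {p : Fin m → Fin n}

theorem apply_pivot (h : HasPivots E p) (i k : Fin m) : E i (p k) = if i = k then 1 else 0 := by
  have := congrFun (congrFun h.submatrix_eq_one i) k
  simpa [Matrix.one_apply] using this

theorem isLeading_iff (h : HasPivots E p) {i : Fin m} {j : Fin n} :
    IsLeading E i j ↔ j = p i := by
  constructor
  · rintro ⟨h1, h2⟩
    rcases lt_trichotomy j (p i) with hj | hj | hj
    · exact absurd (h.eq_zero_of_lt i j hj) h1
    · exact hj
    · have := h2 _ hj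
      simp [h.apply_pivot] at this
  · rintro rfl
    exact ⟨by simp [h.apply_pivot], h.eq_zero_of_lt i⟩

theorem isRREF (h : HasPivots E p) : IsRREF E := by
  refine ⟨fun i j hj => ?_, fun i i' j' hi hj' => ⟨p i, ?_, h.isLeading_iff.2 rfl⟩⟩
  · rw [h.isLeading_iff] at hj
    subst hj
    simp +contextual [h.apply_pivot]
  · rw [h.isLeading_iff.1 hj']
    exact h.strictMono hi

theorem transpose_mulVec_pivot (h : HasPivots E p) (l : Fin m → K) (i : Fin m) :
    (Eᵀ *ᵥ l) (p i) = l i := by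
  simp [Matrix.mulVec, dotProduct, h.apply_pivot]

/-- The matrix selecting the pivot coordinates is a right inverse of `E` after transposition. -/
theorem mul_transpose (h : HasPivots E p) :
    E * ((1 : Matrix (Fin n) (Fin n) K).submatrix p id)ᵀ = 1 := by
  rw [← h.submatrix_eq_one]
  ext i k
  simp [Matrix.mul_apply, Matrix.one_apply]

theorem surjective (h : HasPivots E p) : Function.Surjective E.mulVec := fun v =>
  ⟨((1 : Matrix (Fin n) (Fin n) K).submatrix p id)ᵀ *ᵥ v, by
    rw [Matrix.mulVec_mulVec, h.mul_transpose, Matrix.one_mulVec]⟩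

theorem le (h : HasPivots E p) : m ≤ n := by
  simpa using Fintype.card_le_of_injective p h.strictMono.injective

end HasPivots

/-- The columns in which some vector of `V` has its first nonzero entry. -/
def leadingSet {n : ℕ} (V : Submodule K (Fin n → K)) : Set (Fin n) :=
  {j | ∃ v ∈ V, v j ≠ 0 ∧ ∀ j' < j, v j' = 0}

theorem exists_leading {n : ℕ} {v : Fin n → K} (hv : v ≠ 0) :
    ∃ j, v j ≠ 0 ∧ ∀ j' < j, v j' = 0 := by
  obtain ⟨j, hj, hmin⟩ := WellFounded.has_min (wellFounded_lt (α := Fin n)) {j | v j ≠ 0}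
    (Function.ne_iff.1 hv)
  exact ⟨j, hj, fun j' h => by_contra fun h' => hmin j' h' h⟩

theorem IsRREF.exists_hasPivots {m n : ℕ} {E : Matrix (Fin m) (Fin n) K} (h : IsRREF E)
    (hs : Function.Surjective E.mulVec) : ∃ p, HasPivots E p := by
  have hrow : ∀ i, ∃ j, IsLeading E i j := by
    intro i
    refine exists_leading fun h0 => ?_
    obtain ⟨v, hv⟩ := hs (Pi.single i 1)
    have := congrFun hv i
    simp [Matrix.mulVec, h0] at this
  choose p hp using hrow
  refine ⟨p, fun i i' hi => ?_, ?_, fun i => (hp i).2⟩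
  · obtain ⟨j, hj, hl⟩ := h.2 i i' _ hi (hp i')
    rcases lt_trichotomy j (p i) with hji | hji | hji
    · exact absurd ((hp i).2 j hji) hl.1
    · rwa [← hji]
    · exact absurd (hl.2 _ hji) (hp i).1
  · ext i k
    by_cases hik : i = k
    · subst hik; simp [(h.1 i _ (hp i)).1]
    · simp [hik, (h.1 k _ (hp k)).2 i hik]

/-- The row space of a matrix. -/
def rowSpace {m n : ℕ} (E : Matrix (Fin m) (Fin n) K) : Submodule K (Fin n → K) :=
  LinearMap.range (Matrix.mulVecLin Eᵀ)

theorem mem_rowSpace {m n : ℕ} {E : Matrix (Fin m) (Fin n) K} {v : Fin n → K} :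
    v ∈ rowSpace E ↔ ∃ l, Eᵀ *ᵥ l = v := Iff.rfl

theorem row_mem_rowSpace {m n : ℕ} (E : Matrix (Fin m) (Fin n) K) (i : Fin m) :
    E i ∈ rowSpace E := ⟨Pi.single i 1, by ext j; simp⟩

namespace HasPivots

variable {m n : ℕ} {E : Matrix (Fin m) (Fin n) K} {p : Fin m → Fin n}

theorem eq_transpose_mulVec (h : HasPivots E p) {v : Fin n → K} (hv : v ∈ rowSpace E) :
    v = Eᵀ *ᵥ (v ∘ p) := by
  obtain ⟨l, rfl⟩ := hv
  rw [Matrix.mulVecLin_apply, show (Eᵀ *ᵥ l) ∘ p = l from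
    funext fun i => h.transpose_mulVec_pivot l i]

theorem eq_zero_of_mem_rowSpace (h : HasPivots E p) {v : Fin n → K} (hv : v ∈ rowSpace E)
    (h0 : ∀ i, v (p i) = 0) : v = 0 := by
  rw [h.eq_transpose_mulVec hv, show v ∘ p = 0 from funext h0, Matrix.mulVec_zero]

theorem range_eq_leadingSet (h : HasPivots E p) : Set.range p = leadingSet (rowSpace E) := by
  ext j
  constructor
  · rintro ⟨i, rfl⟩
    exact ⟨E i, row_mem_rowSpace E i, h.isLeading_iff.2 rfl⟩
  · rintro ⟨v, hv, hj, hlt⟩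
    obtain ⟨l, rfl⟩ := hv
    have hl : l ≠ 0 := by rintro rfl; simp at hj
    obtain ⟨i, hi, hmin⟩ := exists_leading hl
    have hz : ∀ j' < p i, (Eᵀ *ᵥ l) j' = 0 := by
      intro j' hj'
      rw [Matrix.mulVec, dotProduct]
      refine Finset.sum_eq_zero fun k _ => ?_
      rcases lt_or_ge k i with hk | hk
      · simp [hmin k hk]
      · simp [h.eq_zero_of_lt k j' (hj'.trans_le (h.strictMono.monotone hk))]
    have hnz := h.transpose_mulVec_pivot l i
    rcases lt_trichotomy j (p i) with hji | hji | hji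
    · exact absurd (hz j hji) hj
    · exact ⟨i, hji.symm⟩
    · have := hlt _ hji
      rw [Matrix.mulVecLin_apply, hnz] at this
      exact absurd this hi

end HasPivots

theorem HasPivots.height_eq {m m' n : ℕ} {E : Matrix (Fin m) (Fin n) K}
    {E' : Matrix (Fin m') (Fin n) K} {p : Fin m → Fin n} {p' : Fin m' → Fin n}
    (h : HasPivots E p) (h' : HasPivots E' p') (hr : rowSpace E = rowSpace E') : m = m' := by
  have hp : Set.range p = Set.range p' := by
    rw [h.range_eq_leadingSet, h'.range_eq_leadingSet, hr]
  have h1 := Set.card_range_of_injective h.strictMono.injective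
  have h2 := Set.card_range_of_injective h'.strictMono.injective
  simp only [← Nat.card_eq_fintype_card, hp] at h1 h2
  simpa using h1.symm.trans h2

/-- A subspace has at most one basis in reduced row echelon form. -/
theorem HasPivots.unique {m n : ℕ} {E E' : Matrix (Fin m) (Fin n) K} {p p' : Fin m → Fin n}
    (h : HasPivots E p) (h' : HasPivots E' p') (hr : rowSpace E = rowSpace E') :
    E = E' ∧ p = p' := by
  have hp : p = p' := (h.strictMono.range_inj h'.strictMono).1 <| by
    rw [h.range_eq_leadingSet, h'.range_eq_leadingSet, hr]
  subst hp
  refine ⟨?_, rfl⟩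
  ext i : 1
  have hi : E i ∈ rowSpace E' := hr ▸ row_mem_rowSpace E i
  rw [h'.eq_transpose_mulVec hi, h'.eq_transpose_mulVec (row_mem_rowSpace E' i)]
  congr 1
  ext k
  simp [h.apply_pivot, h'.apply_pivot]

/-- Eliminating the later leading columns one after the other turns a vector with leading
column `j` into a row of the echelon basis. -/
theorem exists_reduced_vector {n : ℕ} (V : Submodule K (Fin n → K)) {j : Fin n}
    (hj : j ∈ leadingSet V) (N : ℕ) :
    ∃ v ∈ V, v j = 1 ∧ (∀ k < j, v k = 0) ∧
      ∀ q ∈ leadingSet V, j < q → (q : ℕ) < N → v q = 0 := by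
  induction N with
  | zero =>
    obtain ⟨v, hv, h1, h2⟩ := hj
    exact ⟨(v j)⁻¹ • v, V.smul_mem _ hv, by simp [h1], fun k hk => by simp [h2 k hk],
      fun q _ _ h => absurd h (Nat.not_lt_zero _)⟩
  | succ N ih =>
    obtain ⟨v, hv, h1, h2, h3⟩ := ih
    by_cases hN : ∃ q ∈ leadingSet V, j < q ∧ (q : ℕ) = N
    · obtain ⟨q, ⟨g, hg, hg1, hg2⟩, hjq, rfl⟩ := hN
      refine ⟨v - (v q * (g q)⁻¹) • g, V.sub_mem hv (V.smul_mem _ hg), ?_, ?_, ?_⟩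
      · simp [h1, hg2 j hjq]
      · intro k hk
        simp [h2 k hk, hg2 k (hk.trans hjq)]
      · intro r hr hjr hrN
        rcases (Nat.lt_succ_iff_lt_or_eq.1 hrN) with hlt | heq
        · simp [h3 r hr hjr hlt, hg2 r hlt]
        · rw [Fin.ext heq]
          simp [hg1]
    · refine ⟨v, hv, h1, h2, fun r hr hjr hrN => ?_⟩
      rcases (Nat.lt_succ_iff_lt_or_eq.1 hrN) with hlt | heq
      · exact h3 r hr hjr hlt
      · exact absurd ⟨r, hr, hjr, heq⟩ hN

/-- Every subspace has a basis in reduced row echelon form. -/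
theorem exists_hasPivots {n : ℕ} (V : Submodule K (Fin n → K)) :
    ∃ (m : ℕ) (E : Matrix (Fin m) (Fin n) K) (p : Fin m → Fin n),
      HasPivots E p ∧ rowSpace E = V := by
  classical
  let P : Finset (Fin n) := (leadingSet V).toFinset
  have hP : ∀ j, j ∈ P ↔ j ∈ leadingSet V := fun j => Set.mem_toFinset
  let p : Fin P.card → Fin n := P.orderEmbOfFin rfl
  have hp : ∀ i, p i ∈ leadingSet V := fun i => (hP _).1 (P.orderEmbOfFin_mem rfl i)
  choose E hE h1 h2 h3 using fun i => exists_reduced_vector V (hp i) n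
  have hpiv : HasPivots (Matrix.of E) p := by
    refine ⟨(P.orderEmbOfFin rfl).strictMono, ?_, fun i => h2 i⟩
    ext i k
    rcases lt_trichotomy i k with hik | hik | hik
    · have hlt : p i < p k := (P.orderEmbOfFin rfl).strictMono hik
      simpa [hik.ne] using h3 i (p k) (hp k) hlt (p k).2
    · subst hik; simpa using h1 i
    · have hlt : p k < p i := (P.orderEmbOfFin rfl).strictMono hik
      simpa [hik.ne'] using h2 i (p k) hlt
  have hmem : ∀ l, (Matrix.of E)ᵀ *ᵥ l ∈ V := by
    intro l
    have : (Matrix.of E)ᵀ *ᵥ l = ∑ i, l i • E i := by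
      ext j
      simp [Matrix.mulVec, dotProduct, mul_comm]
    rw [this]
    exact V.sum_mem fun i _ => V.smul_mem _ (hE i)
  refine ⟨P.card, Matrix.of E, p, hpiv, le_antisymm ?_ ?_⟩
  · rintro _ ⟨l, rfl⟩
    exact hmem l
  · intro v hv
    rw [mem_rowSpace]
    refine ⟨v ∘ p, ?_⟩
    -- the difference lies in `V` but vanishes in all leading columns of `V`
    by_contra hne
    obtain ⟨j, hj, hlt⟩ := exists_leading (sub_ne_zero.2 hne)
    have hjP : j ∈ P := (hP j).2 ⟨_, V.sub_mem (hmem _) hv, hj, hlt⟩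
    obtain ⟨i, rfl⟩ : j ∈ Set.range p := by
      rw [show Set.range p = P from P.range_orderEmbOfFin rfl]
      exact hjP
    exact hj (by simp [hpiv.transpose_mulVec_pivot])

/-! ### Reduction modulo the row space -/

/-- Subtract from a vector the vector of the row space of `E` with the same pivot coordinates. -/
def reduction {m n : ℕ} (E : Matrix (Fin m) (Fin n) K) (p : Fin m → Fin n) :
    Matrix (Fin n) (Fin n) K :=
  1 - Eᵀ * (1 : Matrix (Fin n) (Fin n) K).submatrix p id

namespace HasPivots

variable {m n : ℕ} {E : Matrix (Fin m) (Fin n) K} {p : Fin m → Fin n}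

theorem reduction_mulVec (u : Fin n → K) : reduction E p *ᵥ u = u - Eᵀ *ᵥ (u ∘ p) := by
  rw [reduction, Matrix.sub_mulVec, Matrix.one_mulVec, ← Matrix.mulVec_mulVec]
  congr 2
  ext i
  simp [Matrix.mulVec, dotProduct, Matrix.one_apply]

theorem reduction_mulVec_pivot (h : HasPivots E p) (u : Fin n → K) (i : Fin m) :
    (reduction E p *ᵥ u) (p i) = 0 := by
  rw [reduction_mulVec, Pi.sub_apply, h.transpose_mulVec_pivot]
  simp

theorem mul_transpose_reduction (h : HasPivots E p) : E * (reduction E p)ᵀ = 0 := by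
  rw [reduction, Matrix.transpose_sub, Matrix.transpose_mul, Matrix.transpose_transpose,
    Matrix.mul_sub, ← Matrix.mul_assoc, h.mul_transpose]
  simp

theorem transpose_reduction_mulVec {x : Fin n → K} (hx : E *ᵥ x = 0) :
    (reduction E p)ᵀ *ᵥ x = x := by
  rw [reduction, Matrix.transpose_sub, Matrix.transpose_mul, Matrix.transpose_transpose,
    Matrix.sub_mulVec, ← Matrix.mulVec_mulVec, hx]
  simp

theorem transpose_mulVec_reduction (h : HasPivots E p) (u : Fin n → K) :
    E *ᵥ ((reduction E p)ᵀ *ᵥ u) = 0 := by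
  rw [Matrix.mulVec_mulVec, h.mul_transpose_reduction, Matrix.zero_mulVec]

end HasPivots

/-! ### Uniqueness of normal forms -/

/-- The conditions of a reducedAP-form with nonempty interpretation, with the pivot columns
named. -/
structure APForm.IsNormal {n : ℕ} (D : APForm K n) (p : Fin D.m → Fin n) : Prop where
  hasPivots : HasPivots D.E p
  Y_pivot : ∀ i k, D.Y k (p i) = 0
  y_pivot : ∀ i, D.y (p i) = 0

/-- The solutions `(z, x)` of the linear equations to which an AP-form amounts. -/
def APForm.Solves {n : ℕ} (D : APForm K n) (a : (Fin n → K) × (Fin n → K)) : Prop :=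
  D.E *ᵥ a.2 = -D.x ∧ signTwist D.Y *ᵥ a.2 - D.y - a.1 ∈ rowSpace D.E

theorem APForm.IsNormal.exists_solves_snd {n : ℕ} {D : APForm K n} {p : Fin D.m → Fin n}
    (h : D.IsNormal p) : ∃ x, D.E *ᵥ x = -D.x := h.hasPivots.surjective _

theorem APForm.IsNormal.twist_pivot {n : ℕ} {D : APForm K n} {p : Fin D.m → Fin n}
    (h : D.IsNormal p) (i : Fin D.m) (u : Fin n → K) : (signTwist D.Y *ᵥ u) (p i) = 0 := by
  rw [Matrix.mulVec, dotProduct]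
  refine Finset.sum_eq_zero fun k _ => ?_
  rw [signTwist_apply_eq_zero ((D.Y_symm.apply k (p i)).trans (h.Y_pivot i k)), zero_mul]

/-- The row space is the set of differences of first coordinates over a fixed `x`. -/
theorem APForm.IsNormal.mem_rowSpace_iff {n : ℕ} {D : APForm K n} {p : Fin D.m → Fin n}
    (h : D.IsNormal p) (v : Fin n → K) :
    v ∈ rowSpace D.E ↔ ∃ z x, D.Solves (z, x) ∧ D.Solves (z + v, x) := by
  constructor
  · intro hv
    obtain ⟨x, hx⟩ := h.exists_solves_snd
    refine ⟨signTwist D.Y *ᵥ x - D.y, x, ⟨hx, by simp⟩, hx, ?_⟩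
    simpa using (rowSpace D.E).neg_mem hv
  · rintro ⟨z, x, ⟨-, h1⟩, -, h2⟩
    have := (rowSpace D.E).sub_mem h1 h2
    convert this using 1
    simp only
    abel

/-- Two normal forms with the same solutions agree: the solutions determine the row space, which
determines the echelon matrix. The difference of the two quadratic parts lies in the row space
and vanishes in the pivot columns, so it is zero. -/
theorem APForm.IsNormal.unique {n : ℕ} {D D' : APForm K n} {p : Fin D.m → Fin n}
    {p' : Fin D'.m → Fin n} (h : D.IsNormal p) (h' : D'.IsNormal p')
    (hs : ∀ a, D.Solves a ↔ D'.Solves a) : D = D' := by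
  have hr : rowSpace D.E = rowSpace D'.E := by
    ext v
    simp only [h.mem_rowSpace_iff, h'.mem_rowSpace_iff, hs]
  have hm := h.hasPivots.height_eq h'.hasPivots hr
  obtain ⟨m, E, Y, Ys, x, y⟩ := D
  obtain ⟨m', E', Y', Ys', x', y'⟩ := D'
  obtain rfl : m = m' := hm
  obtain ⟨hE, hp⟩ := h.hasPivots.unique h'.hasPivots hr
  simp only at hE
  subst hE hp
  have hpt : ∀ u, E *ᵥ u = -x → x = x' ∧ signTwist Y *ᵥ u - y = signTwist Y' *ᵥ u - y' := by
    intro u hu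
    have h1 : APForm.Solves ⟨m, E, Y, Ys, x, y⟩ (signTwist Y *ᵥ u - y, u) := ⟨hu, by simp⟩
    have h2 := (hs _).1 h1
    refine ⟨neg_injective (hu.symm.trans h2.1), ?_⟩
    refine (sub_eq_zero.1 (h.hasPivots.eq_zero_of_mem_rowSpace h2.2 fun i => ?_)).symm
    have e1 := h.twist_pivot i u
    have e2 := h'.twist_pivot i u
    have e3 := h.y_pivot i
    have e4 := h'.y_pivot i
    simp only at e1 e2 e3 e4
    simp [e1, e2, e3, e4]
  obtain ⟨u0, hu0⟩ := h.exists_solves_snd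
  simp only at hu0
  obtain ⟨hx, h0⟩ := hpt u0 hu0
  have hker : ∀ w, E *ᵥ w = 0 → signTwist Y *ᵥ w = signTwist Y' *ᵥ w := by
    intro w hw
    have := (hpt (u0 + w) (by rw [Matrix.mulVec_add, hu0, hw, add_zero])).2
    rw [Matrix.mulVec_add, Matrix.mulVec_add] at this
    have := congrArg₂ (· - ·) this h0
    simpa [add_sub_right_comm] using this
  -- the columns of `reductionᵀ` span the kernel of `E`
  have hYY : signTwist Y * (reduction E p)ᵀ = signTwist Y' * (reduction E p)ᵀ := by
    refine Matrix.ext_of_mulVec_single fun j => ?_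
    rw [← Matrix.mulVec_mulVec, ← Matrix.mulVec_mulVec]
    exact hker _ (h.hasPivots.transpose_mulVec_reduction _)
  -- a matrix whose pivot columns vanish is not changed by the reduction
  have habs : ∀ B : Matrix (Fin n) (Fin n) K, (∀ i k, B k (p i) = 0) →
      B * (reduction E p)ᵀ = B := by
    intro B hB
    have : B * ((1 : Matrix (Fin n) (Fin n) K).submatrix p id)ᵀ = 0 := by
      ext k i
      simp [Matrix.mul_apply, Matrix.one_apply, hB]
    rw [reduction, Matrix.transpose_sub, Matrix.transpose_mul, Matrix.transpose_transpose,
      Matrix.mul_sub, ← Matrix.mul_assoc, this]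
    simp
  rw [habs (signTwist Y) fun i k => signTwist_apply_eq_zero (h.Y_pivot i k),
    habs (signTwist Y') fun i k => signTwist_apply_eq_zero (h'.Y_pivot i k)] at hYY
  obtain rfl : Y = Y' := by rw [← signTwist_signTwist Y, hYY, signTwist_signTwist]
  obtain rfl : y = y' := sub_right_injective h0
  subst hx
  rfl

/-! ### Coordinates of states -/

/-- The coordinates `(z, x)` of a state. -/
def stateEquiv (K : Type*) [Field K] (n : ℕ) :
    RelSpace K 0 n ≃ₗ[K] (Fin n → K) × (Fin n → K) where
  toFun q := (fun j => (q.2 j).1, fun j => (q.2 j).2)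
  invFun a := (0, fun j => (a.1 j, a.2 j))
  left_inv _ := Prod.ext (Subsingleton.elim _ _) rfl
  right_inv _ := rfl
  map_add' _ _ := rfl
  map_smul' _ _ := rfl

theorem twistedOmega_eq {n : ℕ} (q r : RelSpace K 0 n) :
    twistedOmega q r = (stateEquiv K n q).2 ⬝ᵥ (stateEquiv K n r).1 -
      (stateEquiv K n q).1 ⬝ᵥ (stateEquiv K n r).2 := by
  simp [twistedOmega, omega, stateEquiv, dotProduct]

theorem APForm.mem_interp_iff_solves {n : ℕ} (D : APForm K n) (q : RelSpace K 0 n) :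
    q ∈ D.interp ↔ D.Solves (stateEquiv K n q) := by
  rw [D.mem_interp, APForm.Solves, mem_rowSpace]
  refine and_congr Iff.rfl (exists_congr fun l => ?_)
  refine ⟨fun h => ?_, fun h => ?_⟩
  · simp only [stateEquiv, LinearEquiv.coe_mk, LinearMap.coe_mk, AddHom.coe_mk, h]
    abel
  · rw [h]
    simp [stateEquiv]

/-! ### Existence of normal forms -/

/-- Let `V` be the fibre over `x = 0` of a Lagrangian subspace `M` and `W` its set of second
coordinates. They are each other's orthogonal complements, so an echelon basis `E` of `V` has
`W` as its kernel. -/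
theorem exists_pivots_of_lagrangian {n : ℕ} {M : Submodule K ((Fin n → K) × (Fin n → K))}
    (hM : ∀ a, a ∈ M ↔ ∀ b ∈ M, a.2 ⬝ᵥ b.1 = a.1 ⬝ᵥ b.2) :
    ∃ (m : ℕ) (E : Matrix (Fin m) (Fin n) K) (p : Fin m → Fin n), HasPivots E p ∧
      (∀ z, z ∈ rowSpace E ↔ (z, 0) ∈ M) ∧ ∀ x, E *ᵥ x = 0 ↔ ∃ z, (z, x) ∈ M := by
  obtain ⟨m, E, p, hp, hE⟩ := exists_hasPivots (M.comap (LinearMap.inl K _ _))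
  have hV : ∀ z, z ∈ rowSpace E ↔ (z, 0) ∈ M := fun z => by rw [hE]; rfl
  refine ⟨m, E, p, hp, hV, fun x => ⟨fun hx => ?_, ?_⟩⟩
  · by_contra hne
    have hW : x ∉ M.map (LinearMap.snd K _ _) := by
      rintro ⟨⟨z, x'⟩, hm, rfl⟩
      exact hne ⟨z, hm⟩
    obtain ⟨f, hf, hker⟩ := Submodule.exists_le_ker_of_notMem hW
    let z : Fin n → K := fun j => f (Pi.single j 1)
    have hz : ∀ u, f u = z ⬝ᵥ u := by
      intro u
      rw [LinearMap.pi_apply_eq_sum_univ f u]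
      simp only [dotProduct, z, smul_eq_mul]
      refine Finset.sum_congr rfl fun j _ => ?_
      rw [mul_comm]
      congr 2
      ext k
      simp [Pi.single_apply, eq_comm]
    have hzM : (z, 0) ∈ M := (hM _).2 fun b hb => by
      have : f b.2 = 0 := hker ⟨b, hb, rfl⟩
      rw [← hz, this]
      simp
    obtain ⟨l, hl⟩ := (hV z).2 hzM
    apply hf
    rw [hz, ← hl, Matrix.mulVecLin_apply, Matrix.mulVec_transpose, ← Matrix.dotProduct_mulVec, hx,
      dotProduct_zero]
  · rintro ⟨z, hz⟩
    ext i
    have := (hM _).1 ((hV _).1 (row_mem_rowSpace E i)) _ hz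
    simpa [Matrix.mulVec] using this.symm

/-- Every affine Lagrangian subspace is the solution set of a normal form. Lift the columns of
`reductionᵀ`, which span the kernel of `E`, to the subspace and reduce the lifts modulo the row
space: this gives a matrix `B`, and isotropy makes it symmetric. -/
theorem exists_isNormal_of_lagrangian {n : ℕ} {M : Submodule K ((Fin n → K) × (Fin n → K))}
    (hM : ∀ a, a ∈ M ↔ ∀ b ∈ M, a.2 ⬝ᵥ b.1 = a.1 ⬝ᵥ b.2) (a₀ : (Fin n → K) × (Fin n → K)) :
    ∃ (D : APForm K n) (p : Fin D.m → Fin n), D.IsNormal p ∧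
      ∀ a, D.Solves a ↔ a - a₀ ∈ M := by
  obtain ⟨m, E, p, hp, hV, hW⟩ := exists_pivots_of_lagrangian hM
  set r := reduction E p with hr
  have hred : ∀ u, u - r *ᵥ u ∈ rowSpace E := fun u =>
    ⟨u ∘ p, by rw [hr, HasPivots.reduction_mulVec, Matrix.mulVecLin_apply]; abel⟩
  have hcol : ∀ j, ∃ z, (z, rᵀ *ᵥ Pi.single j 1) ∈ M := fun j =>
    (hW _).1 (hp.transpose_mulVec_reduction _)
  choose c hc using hcol
  let N : Matrix (Fin n) (Fin n) K := (Matrix.of c)ᵀ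
  have hN : ∀ u, (N *ᵥ u, rᵀ *ᵥ u) ∈ M := by
    intro u
    have : (N *ᵥ u, rᵀ *ᵥ u) = ∑ j, u j • (c j, rᵀ *ᵥ Pi.single j 1) := by
      refine Prod.ext ?_ ?_
      · ext k
        simp [Prod.fst_sum, N, Matrix.mulVec, dotProduct, mul_comm]
      · ext k
        simp [Prod.snd_sum, Matrix.mulVec, dotProduct, mul_comm]
    rw [this]
    exact M.sum_mem fun j _ => M.smul_mem _ (hc j)
  set B := r * N with hB
  have hBM : ∀ u, (B *ᵥ u, rᵀ *ᵥ u) ∈ M := by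
    intro u
    have := M.sub_mem (hN u) ((hV _).1 (hred (N *ᵥ u)))
    simpa [hB, Matrix.mulVec_mulVec] using this
  have hBsymm : B.IsSymm := by
    refine Matrix.IsSymm.ext fun j k => ?_
    have hentry : ∀ j k, (rᵀ *ᵥ Pi.single j 1) ⬝ᵥ (N *ᵥ Pi.single k 1) = B j k := by
      intro j k
      rw [Matrix.mulVec_transpose, ← Matrix.dotProduct_mulVec, Matrix.mulVec_mulVec, ← hB]
      simp
    have := (hM _).1 (hN (Pi.single j 1)) _ (hN (Pi.single k 1))
    rw [dotProduct_comm (N *ᵥ _, _).1] at this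
    exact (hentry k j).symm.trans (this.symm.trans (hentry j k))
  have hBp : ∀ i k, B (p i) k = 0 := by
    intro i k
    have := hp.reduction_mulVec_pivot (N *ᵥ Pi.single k 1) i
    rw [Matrix.mulVec_mulVec, ← hr, ← hB] at this
    simpa using this
  let v := a₀.1 - B *ᵥ a₀.2
  refine ⟨⟨m, E, signTwist B, signTwist_isSymm hBsymm, -(E *ᵥ a₀.2), -(r *ᵥ v)⟩, p,
    ⟨hp, fun i k => ?_, fun i => ?_⟩, fun a => ?_⟩
  · exact signTwist_apply_eq_zero ((hBsymm.apply (p i) k).trans (hBp i k))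
  · simp [hr, hp.reduction_mulVec_pivot]
  · simp only [APForm.Solves, signTwist_signTwist, neg_neg]
    have hx : E *ᵥ a.2 = E *ᵥ a₀.2 ↔ E *ᵥ (a.2 - a₀.2) = 0 := by
      rw [Matrix.mulVec_sub, sub_eq_zero]
    have hz : E *ᵥ (a.2 - a₀.2) = 0 →
        (B *ᵥ a.2 - -(r *ᵥ v) - a.1 ∈ rowSpace E ↔ a - a₀ ∈ M) := by
      intro h0
      have h1 := hBM (a.2 - a₀.2)
      rw [HasPivots.transpose_reduction_mulVec h0] at h1
      rw [← Submodule.add_mem_iff_left _ (hred v), hV, ← Submodule.sub_mem_iff_right M h1]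
      apply iff_of_eq
      congr 1
      refine Prod.ext ?_ ?_
      · simp only [v, Matrix.mulVec_sub, Prod.fst_sub]
        abel
      · simp
    rw [hx]
    constructor
    · rintro ⟨h0, h1⟩
      exact (hz h0).1 h1
    · intro h1
      have h0 := (hW _).2 ⟨_, h1⟩
      exact ⟨h0, (hz h0).2 h1⟩

/-! ### Reduced AP-forms of affine Lagrangian states -/

theorem APForm.isReduced_iff {n : ℕ} {D : APForm K n} (hne : D.interp.Nonempty) :
    D.IsReduced ↔ ∃ p, D.IsNormal p := by
  rw [APForm.IsReduced, or_iff_right hne.ne_empty]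
  constructor
  · rintro ⟨h1, h2, h3, h4⟩
    obtain ⟨p, hp⟩ := h1.exists_hasPivots h2
    exact ⟨p, hp, fun i k => h3 i _ (hp.isLeading_iff.2 rfl) k,
      fun i => h4 i _ (hp.isLeading_iff.2 rfl)⟩
  · rintro ⟨p, hp, h3, h4⟩
    refine ⟨hp.isRREF, hp.surjective, fun i j hj k => ?_, fun i j hj => ?_⟩
    · rw [hp.isLeading_iff.1 hj, h3]
    · rw [hp.isLeading_iff.1 hj, h4]

theorem existsUnique_apForm {n : ℕ} (L : AffineSubspace K (RelSpace K 0 n))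
    (hL : IsAffineLagrangian L) (hne : (L : Set (RelSpace K 0 n)).Nonempty) :
    ∃! D : APForm K n, D.IsReduced ∧ D.interp = (L : Set (RelSpace K 0 n)) := by
  obtain ⟨q₀, hq₀⟩ := hne
  have hlag : IsLagrangian L.direction := hL.resolve_left (Set.nonempty_iff_ne_empty.1 ⟨q₀, hq₀⟩)
  obtain ⟨D, p, hD, hsol⟩ := exists_isNormal_of_lagrangian
    (M := L.direction.map (stateEquiv K n).toLinearMap) (fun a => by
      have h1 : ∀ q, q ∈ L.direction ↔ ∀ s ∈ L.direction, twistedOmega q s = 0 := fun q =>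
        Set.ext_iff.1 hlag q
      obtain ⟨q, rfl⟩ := (stateEquiv K n).surjective a
      simp only [Submodule.mem_map, LinearEquiv.coe_coe, EmbeddingLike.apply_eq_iff_eq,
        exists_eq_right, forall_exists_index, and_imp, forall_apply_eq_imp_iff₂]
      rw [h1]
      simp only [twistedOmega_eq, sub_eq_zero]) (stateEquiv K n q₀)
  have hint : D.interp = (L : Set (RelSpace K 0 n)) := by
    ext q
    rw [D.mem_interp_iff_solves, hsol, ← map_sub]
    simp only [Submodule.mem_map, LinearEquiv.coe_coe, EmbeddingLike.apply_eq_iff_eq,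
        exists_eq_right]
    exact AffineSubspace.vsub_right_mem_direction_iff_mem hq₀ q
  refine ⟨D, ⟨(APForm.isReduced_iff (hint ▸ ⟨q₀, hq₀⟩)).2 ⟨p, hD⟩, hint⟩, ?_⟩
  rintro D' ⟨hr, hint'⟩
  obtain ⟨p', hD'⟩ := (APForm.isReduced_iff (hint' ▸ ⟨q₀, hq₀⟩)).1 hr
  refine hD'.unique hD fun a => ?_
  obtain ⟨q, rfl⟩ := (stateEquiv K n).surjective a
  rw [← APForm.mem_interp_iff_solves, ← APForm.mem_interp_iff_solves, hint, hint']

/-! ### Block data -/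

theorem IsLeading.unique {m n : ℕ} {E : Matrix (Fin m) (Fin n) K} {i : Fin m} {j j' : Fin n}
    (h : IsLeading E i j) (h' : IsLeading E i j') : j = j' := by
  rcases lt_trichotomy j j' with hlt | heq | hlt
  · exact absurd (h'.2 j hlt) h.1
  · exact heq
  · exact absurd (h.2 j' hlt) h'.1

theorem IsLeading.congr {m n : ℕ} {E E' : Matrix (Fin m) (Fin n) K} (he : E = E') {i : Fin m}
    {j : Fin n} (h : IsLeading E i j) : IsLeading E' i j := he ▸ h

theorem sum_equiv_ext {m n k : ℕ} {e e' : Fin n ≃ Fin m ⊕ Fin k}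
    (hl : ∀ i, e.symm (.inl i) = e'.symm (.inl i))
    (h : StrictMono fun j => e.symm (.inr j)) (h' : StrictMono fun j => e'.symm (.inr j)) :
    e = e' := by
  have hrange : ∀ e : Fin n ≃ Fin m ⊕ Fin k, ∀ j,
      j ∈ Set.range (fun j => e.symm (.inr j)) ↔ ∀ i, e.symm (.inl i) ≠ j := by
    intro e j
    obtain ⟨i | i, rfl⟩ := e.symm.surjective j <;> simp
  have hr : (fun j => e.symm (.inr j)) = fun j => e'.symm (.inr j) := by
    refine (h.range_inj h').1 ?_
    ext j
    rw [hrange, hrange]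
    simp only [hl]
  have hs : e.symm = e'.symm := Equiv.ext fun a => by
    rcases a with i | j
    · exact hl i
    · exact congrFun hr j
  simpa using congrArg Equiv.symm hs

/-- Block data with separated pivots are determined by their AP-form: the permutation is the
only one that enumerates the pivot and the non-pivot columns increasingly. -/
theorem BlockData.SeparatesPivots.eq_of_toAPForm_eq {n : ℕ} {d d' : BlockData K n}
    (h : d.SeparatesPivots) (h' : d'.SeparatesPivots) (he : d.toAPForm = d'.toAPForm) :
    d = d' := by
  obtain ⟨m, hle, σ, F, x, S, hS, s⟩ := d
  obtain ⟨m', hle', σ', F', x', S', hS', s'⟩ := d'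
  obtain rfl : m = m' := congrArg APForm.m he
  obtain ⟨-, hE, hY, hx, hy⟩ := APForm.mk.inj he
  have hE := eq_of_heq hE
  obtain rfl : x = x' := eq_of_heq hx
  have hsplit : BlockData.split ⟨m, hle, σ, F, x, S, hS, s⟩ =
      BlockData.split ⟨m, hle', σ', F', x, S', hS', s'⟩ := by
    refine sum_equiv_ext (fun i => ?_) h.2.2 h'.2.2
    exact (h.1 i).unique (IsLeading.congr hE.symm (h'.1 i))
  have hσ : σ = σ' := by
    ext j
    have := congrArg (fun e => (finSumFinEquiv (e j) : ℕ)) hsplit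
    simpa [BlockData.split] using this
  subst hσ
  simp only at hE hY hy
  set e := BlockData.split ⟨m, hle, σ, F, x, S, hS, s⟩
  rw [← hsplit] at hE hY hy
  obtain rfl : F = F' := by
    ext i j
    simpa using congrFun (congrFun hE i) (e.symm (.inr j))
  obtain rfl : S = S' := by
    ext i j
    simpa using congrFun (congrFun hY (e.symm (.inr i))) (e.symm (.inr j))
  obtain rfl : s = s' := by
    ext j
    simpa using congrFun hy (e.symm (.inr j))
  rfl

theorem APForm.IsNormal.exists_blockData {n : ℕ} {D : APForm K n} {p : Fin D.m → Fin n}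
    (h : D.IsNormal p) : ∃ d : BlockData K n, d.SeparatesPivots ∧ d.toAPForm = D := by
  obtain ⟨m, E, Y, hY, x, y⟩ := D
  have hp : HasPivots E p := h.hasPivots
  have hYp : ∀ i k, Y k (p i) = 0 := h.Y_pivot
  have hyp : ∀ i, y (p i) = 0 := h.y_pivot
  have hcard : (Finset.univ.map ⟨p, hp.strictMono.injective⟩).card = m := by simp
  let e : Fin m ⊕ Fin (n - m) ≃ Fin n :=
    finSumEquivOfFinset (s := Finset.univ.map ⟨p, hp.strictMono.injective⟩) hcard
      (by rw [Finset.card_compl, hcard, Fintype.card_fin])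
  have hl : ∀ i, e (.inl i) = p i := by
    intro i
    have := Finset.orderEmbOfFin_unique hcard (f := p) (fun i => by simp) hp.strictMono
    rw [this]
    exact finSumEquivOfFinset_inl _ _ i
  have hEl : ∀ i k, E i (e (.inl k)) = (1 : Matrix (Fin m) (Fin m) K) i k := fun i k => by
    rw [hl, hp.apply_pivot, Matrix.one_apply]
  have hYl : ∀ i j, Y j (e (.inl i)) = 0 := fun i j => by rw [hl, hYp]
  have hYl' : ∀ i j, Y (e (.inl i)) j = 0 := fun i j => by rw [← hY.apply, hYl]
  have hyl : ∀ i, y (e (.inl i)) = 0 := fun i => by rw [hl, hyp]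
  have hr : StrictMono fun j => e (.inr j) := by
    intro j k hjk
    simp only [e, finSumEquivOfFinset_inr]
    exact (Finset.orderEmbOfFin _ _).strictMono hjk
  let σ : Equiv.Perm (Fin n) :=
    (e.symm.trans finSumFinEquiv).trans (finCongr (Nat.add_sub_of_le hp.le))
  let d : BlockData K n :=
    ⟨m, hp.le, σ, E.submatrix id fun j => e (.inr j), x,
      Y.submatrix (fun j => e (.inr j)) (fun j => e (.inr j)), hY.submatrix _,
      fun j => y (e (.inr j))⟩
  have hsplit : d.split = e.symm := by
    ext j : 1
    simp [BlockData.split, d, σ]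
  have hE : d.toAPForm.E = E := by
    change (Matrix.fromCols 1 (E.submatrix id fun j => e (.inr j))).submatrix id d.split = E
    rw [hsplit]
    ext i j
    obtain ⟨k | k, rfl⟩ := e.surjective j
    · simp [hEl]
    · simp
  refine ⟨d, ⟨fun i => ?_, ?_, ?_⟩, ?_⟩
  · rw [hE, hsplit, Equiv.symm_symm, hl]
    exact hp.isLeading_iff.2 rfl
  · simpa [hsplit, hl] using hp.strictMono
  · simpa [hsplit] using hr
  · refine APForm.ext rfl (heq_of_eq hE) ?_ HEq.rfl ?_
    · change (Matrix.fromBlocks 0 0 0 (Y.submatrix (fun j => e (.inr j))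
        fun j => e (.inr j))).submatrix d.split d.split = Y
      rw [hsplit]
      ext j k
      obtain ⟨a | a, rfl⟩ := e.surjective j <;> obtain ⟨b | b, rfl⟩ := e.surjective k <;>
        simp [hYl, hYl']
    · change Sum.elim (0 : Fin m → K) (fun j => y (e (.inr j))) ∘ d.split = y
      rw [hsplit]
      ext j
      obtain ⟨a | a, rfl⟩ := e.surjective j <;> simp [hyl]

end GSA

end

theorem mainTheorem5 {K : Type*} [Field K] (n : ℕ)
    (L : AffineSubspace K (GSA.RelSpace K 0 n))
    (hL : GSA.IsAffineLagrangian L) (hne : (L : Set (GSA.RelSpace K 0 n)).Nonempty) :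
    (∃! D : GSA.APForm K n, D.IsReduced ∧ D.interp = (L : Set (GSA.RelSpace K 0 n))) ∧
    (∃! d : GSA.BlockData K n, d.SeparatesPivots ∧ d.toAPForm.IsReduced ∧
      d.toAPForm.interp = (L : Set (GSA.RelSpace K 0 n))) := by
  have ha := GSA.existsUnique_apForm L hL hne
  refine ⟨ha, ?_⟩
  obtain ⟨D, ⟨hr, hi⟩, huniq⟩ := ha
  obtain ⟨p, hp⟩ := (GSA.APForm.isReduced_iff (hi ▸ hne)).1 hr
  obtain ⟨d, hd, rfl⟩ := hp.exists_blockData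
  exact ⟨d, ⟨hd, hr, hi⟩, fun d' ⟨hd', hr', hi'⟩ =>
    hd'.eq_of_toAPForm_eq hd (huniq _ ⟨hr', hi'⟩)⟩
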